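/- Let $(X,\mathcal D)$ be an infinite metric space with its Borel $\sigma$-algebra. An instance $\mathcal I$ of the Lipschitz multi-armed bandit problem on $X$ consists of a function $\mu:X\to[0,1]$ with $|\mu(x)-\mu(y)|\le \mathcal D(x,y)$ for all $x,y\in X$, and, for every arm $x\in X$, a payoff distribution $\mathbb P_x$ on $[0,1]$ with expectation $\mu(x)$, depending measurably on $x$. An algorithm is a (possibly randomized) Borel-measurable decision rule: it has a private random seed $\omega$ drawn from a probability space $\Omega$ and, for each $n\ge 0$, a Markov kernel from $\Omega\times(X\times[0,1])^n$ to $X$; in round $n+1$ the arm $x_{n+1}$ is drawn from this kernel given the seed and the history of the arms and payoffs of the first $n$ rounds, and then a payoff is drawn from $\mathbb P_{x_{n+1}}$, independently of the past given $x_{n+1}$. The algorithm does not depend on $\mathcal I$. Its regret on $\mathcal I$ is $$R_{\mathcal I}(t)=t\,\sup_{x\in X}\mu(x)-\mathbb E\Big[\sum_{s=1}^t\mu(x_s)\Big].$$ The problem on $X$ is called $f(t)$-tractable if there is an algorithm such that for every instance $\mathcal I$ one has $R_{\mathcal I}(t)=O_{\mathcal I}(f(t))$ as $t\to\infty$, where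 the constant may depend on $\mathcal I$. Theorem. The Lipschitz multi-armed bandit problem on any infinite metric space is not $(\log t)$-tractable: for every algorithm there is an instance $\mathcal I$ on which its regret is not $O_{\mathcal I}(\log t)$. -/

import Mathlib

open MeasureTheory ProbabilityTheory

universe u v

namespace LipschitzMAB

/-- A stochastic instance of the Lipschitz bandit problem on the metric space `X`: an expected payoff
function `mean : X → [0,1]` which is Lipschitz with constant `1`, together with a payoff distribution
`payoff x` on `[0,1]` for every arm `x`, depending measurably on `x` and having expectation `mean x`. -/
structure Problem (X : Type u) [MetricSpace X] [MeasurableSpace X] where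
  mean : X → ℝ
  mean_mem : ∀ x, mean x ∈ Set.Icc (0 : ℝ) 1
  lipschitz : LipschitzWith 1 mean
  payoff : Kernel X unitInterval
  isMarkov : IsMarkovKernel payoff
  expectation : ∀ x, ∫ y, (y : ℝ) ∂(payoff x) = mean x

/-- The history of the first `n` rounds: the arm played and the payoff received in each round. -/
abbrev History (X : Type u) (n : ℕ) : Type u := Fin n → X × unitInterval

/-- A randomized bandit algorithm, i.e. a randomized measurable decision rule. It may use a private
random seed, drawn once at the beginning, and fresh randomness in every round: after `n` rounds with
history `h` and with seed `ω` the next arm is drawn from `rule n (ω, h)`. Taking a one-point seed space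
gives sequences of Markov kernels from histories to arms; taking Dirac kernels gives measurable
functions of the seed and of the history. -/
structure Algorithm (X : Type u) [MeasurableSpace X] where
  Seed : Type v
  seedSpace : MeasurableSpace Seed
  seedLaw : Measure Seed
  seedLaw_prob : IsProbabilityMeasure seedLaw
  rule : (n : ℕ) → Kernel (Seed × History X n) X
  rule_markov : ∀ n, IsMarkovKernel (rule n)

attribute [instance] Problem.isMarkov Algorithm.seedSpace Algorithm.seedLaw_prob
  Algorithm.rule_markov

section

variable {X : Type u} [MeasurableSpace X]

/-- Append the arm and the payoff of the current round to the history; the seed is unchanged. -/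
def record {Ω : Type v} {n : ℕ} (z : ((Ω × History X n) × X) × unitInterval) :
    Ω × History X (n + 1) :=
  (z.1.1.1, Fin.snoc (α := fun _ => X × unitInterval) z.1.1.2 (z.1.2, z.2))

theorem measurable_record {Ω : Type v} [MeasurableSpace Ω] {n : ℕ} :
    Measurable (record : ((Ω × History X n) × X) × unitInterval → Ω × History X (n + 1)) := by
  refine Measurable.prodMk (by fun_prop) ?_
  refine measurable_pi_lambda _ fun i => ?_
  induction i using Fin.lastCases with
  | last => simp only [Fin.snoc_last]; fun_prop
  | cast i => simp only [Fin.snoc_castSucc]; fun_prop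

end

section

variable {X : Type u} [MetricSpace X] [MeasurableSpace X]

/-- The joint law of the seed and of the history of the first `n` rounds when algorithm `A` plays
against the instance `I`. In each round the arm is drawn from the rule of the algorithm, given the
seed and the past, and then the payoff is drawn from the payoff distribution of that arm,
independently of everything else given the arm. -/
noncomputable def law (A : Algorithm.{u, v} X) (I : Problem X) :
    (n : ℕ) → Measure (A.Seed × History X n)
  | 0 => A.seedLaw.map fun ω => (ω, Fin.elim0)
  | n + 1 =>
    ((law A I n ⊗ₘ A.rule n) ⊗ₘ Kernel.prodMkLeft (A.Seed × History X n) I.payoff).map record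

instance law_prob (A : Algorithm.{u, v} X) (I : Problem X) (n : ℕ) :
    IsProbabilityMeasure (law A I n) := by
  induction n with
  | zero =>
    exact Measure.isProbabilityMeasure_map (by fun_prop)
  | succ n ih =>
    exact Measure.isProbabilityMeasure_map measurable_record.aemeasurable

/-- The regret `R(t) = t · sup_x μ(x) - E[μ(x_1) + ⋯ + μ(x_t)]`. -/
noncomputable def regret (A : Algorithm.{u, v} X) (I : Problem X) (t : ℕ) : ℝ :=
  t * (⨆ x, I.mean x) - ∫ z, ∑ s : Fin t, I.mean (z.2 s).1 ∂(law A I t)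

end

/-- The Lipschitz bandit problem on `X` is `f(t)`-tractable: a single algorithm has regret
`O(f(t))` on every instance, with a constant that may depend on the instance. -/
def IsTractable (X : Type u) [MetricSpace X] [MeasurableSpace X] (f : ℕ → ℝ) : Prop :=
  ∃ A : Algorithm.{u, v} X, ∀ I : Problem X,
    Asymptotics.IsBigO Filter.atTop (fun t : ℕ => regret A I t) f

end LipschitzMAB

open Filter

/-! An infinite metric space contains infinitely many disjoint balls. The base instance has optimal
mean `1/2` at a point outside countably many of them and a cone-shaped dip in each ball; in the half
ball of radius `r i / 2` an arm loses at least `r i / 8`. Raising the mean near one centre makes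
that half ball optimal, with gap `r i / 8`.

The two instances differ only on the half ball, where each play changes the likelihood by a factor
at least `exp (-3 * r i)`. Logarithmic regret on the raised instance therefore forces about `log t /
r i` plays there under the base instance (`eventually_log_div_le_integral_playCount`). These cost at
least `log t / 96`, whatever the radius (`base_gap`). Since the number of balls is unlimited, no
constant bounds the base regret by `C * log t`. -/

namespace LipschitzMAB

/-! ### Counting plays in a set of arms -/

section PlayCount

variable {X : Type u}

/-- The number of rounds in which an arm of `V` was played. -/
noncomputable def playCount {Ω : Type v} (V : Set X) {t : ℕ} (z : Ω × History X t) : ℝ :=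
  ∑ s, V.indicator 1 (z.2 s).1

theorem playCount_nonneg {Ω : Type v} (V : Set X) {t : ℕ} (z : Ω × History X t) :
    0 ≤ playCount V z :=
  Finset.sum_nonneg fun _ _ => Set.indicator_nonneg (fun _ _ => zero_le_one) _

theorem playCount_le {Ω : Type v} (V : Set X) {t : ℕ} (z : Ω × History X t) :
    playCount V z ≤ t := by
  calc playCount V z ≤ ∑ _s : Fin t, (1 : ℝ) :=
        Finset.sum_le_sum fun _ _ => Set.indicator_le_self' (fun _ _ => zero_le_one) _
    _ = t := by simp

theorem measurable_playCount [MeasurableSpace X] {Ω : Type v} [MeasurableSpace Ω] {V : Set X}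
    (hV : MeasurableSet V) {t : ℕ} : Measurable (playCount V : Ω × History X t → ℝ) := by
  have : Measurable (V.indicator (1 : X → ℝ)) := measurable_one.indicator hV
  unfold playCount
  fun_prop

end PlayCount

/-! ### Change of measure between two instances -/

section ChangeOfMeasure

variable {X : Type u} [MetricSpace X] [MeasurableSpace X]

/-- If the payoff laws of `I` rescaled by `a` are dominated by those of `I'`, then the laws of the
histories rescaled by the product of `a` over the arms played satisfy the same domination. -/
theorem lintegral_mul_prod_law_le (A : Algorithm.{u, v} X) (I I' : Problem X) {a : X → ENNReal}
    (ha : Measurable a) (h : ∀ x, a x • I.payoff x ≤ I'.payoff x) (t : ℕ)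
    {f : A.Seed × History X t → ENNReal} (hf : Measurable f) :
    ∫⁻ z, f z * ∏ s, a (z.2 s).1 ∂(law A I t) ≤ ∫⁻ z, f z ∂(law A I' t) := by
  induction t with
  | zero => simp [law]
  | succ t ih =>
    have hprod : ∀ n : ℕ, Measurable fun z : A.Seed × History X n => ∏ s, a (z.2 s).1 := by
      intro n
      fun_prop
    have hfr : Measurable fun z : ((A.Seed × History X t) × X) × unitInterval => f (record z) :=
      hf.comp measurable_record
    have key : ∀ J : Problem X, ∀ F : A.Seed × History X (t + 1) → ENNReal, Measurable F →
        ∫⁻ z, F z ∂(law A J (t + 1)) = ∫⁻ z, ∫⁻ x, ∫⁻ y, F (record ((z, x), y)) ∂(J.payoff x)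
          ∂(A.rule t z) ∂(law A J t) := by
      intro J F hF
      have hFr : Measurable fun z : ((A.Seed × History X t) × X) × unitInterval => F (record z) :=
        hF.comp measurable_record
      rw [law, lintegral_map hF measurable_record, Measure.lintegral_compProd hFr,
        Measure.lintegral_compProd hFr.lintegral_kernel_prod_right']
      rfl
    rw [key I (fun z => f z * ∏ s, a (z.2 s).1) (hf.mul (hprod _)), key I' _ hf]
    -- The induction hypothesis is applied to the conditional expectation of `f` over the next round
    -- under `I'`.
    refine le_trans ?_ (ih (f := fun z => ∫⁻ x, ∫⁻ y, f (record ((z, x), y)) ∂(I'.payoff x)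
      ∂(A.rule t z)) ?_)
    · refine lintegral_mono fun z => ?_
      have h1 : Measurable fun x => ∫⁻ y, f (record ((z, x), y)) ∂(I'.payoff x) := by
        have := (hfr.lintegral_kernel_prod_right'
          (κ := Kernel.prodMkLeft (A.Seed × History X t) I'.payoff))
        exact this.comp (measurable_prodMk_left (x := z))
      rw [← lintegral_mul_const _ h1]
      refine lintegral_mono fun x => ?_
      have h2 : Measurable fun y => f (record ((z, x), y)) :=
        hfr.comp measurable_prodMk_left
      have h3 : ∀ y, f (record ((z, x), y)) * ∏ s, a ((record ((z, x), y)).2 s).1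
          = (∏ s, a (z.2 s).1) * a x * f (record ((z, x), y)) := by
        intro y
        rw [Fin.prod_univ_castSucc]
        simp [record, mul_comm]
      simp only [h3]
      rw [lintegral_const_mul _ h2, mul_assoc, mul_comm]
      gcongr
      calc a x * ∫⁻ y, f (record ((z, x), y)) ∂(I.payoff x)
          = ∫⁻ y, f (record ((z, x), y)) ∂(a x • I.payoff x) := by
            rw [lintegral_smul_measure, smul_eq_mul]
        _ ≤ _ := lintegral_mono' (h x) le_rfl
    · exact (hfr.lintegral_kernel_prod_right'
        (κ := Kernel.prodMkLeft (A.Seed × History X t) I'.payoff)).lintegral_kernel_prod_right'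

theorem integrable_playCount (A : Algorithm.{u, v} X) (I : Problem X) {V : Set X}
    (hV : MeasurableSet V) (t : ℕ) : Integrable (playCount V) (law A I t) := by
  refine Integrable.of_bound (measurable_playCount hV).aestronglyMeasurable t
    (Eventually.of_forall fun z => ?_)
  rw [Real.norm_of_nonneg (playCount_nonneg V z)]
  exact playCount_le V z

/-- With weight `exp (-c)` on `V` and `1` elsewhere, the product over the history is `exp (-c *
playCount)`, which is at least `exp (-c * n)` on the event. -/
theorem exp_neg_mul_measureReal_le (A : Algorithm.{u, v} X) (I I' : Problem X) {V : Set X}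
    (hV : MeasurableSet V) {c : ℝ} (hc : 0 ≤ c)
    (hin : ∀ x ∈ V, ENNReal.ofReal (Real.exp (-c)) • I.payoff x ≤ I'.payoff x)
    (hout : ∀ x ∉ V, I.payoff x ≤ I'.payoff x) (t : ℕ) (n : ℝ) :
    Real.exp (-(c * n)) * (law A I t).real {z | playCount V z ≤ n}
      ≤ (law A I' t).real {z | playCount V z ≤ n} := by
  have hF : MeasurableSet {z : A.Seed × History X t | playCount V z ≤ n} :=
    measurableSet_le (measurable_playCount hV) measurable_const
  have ha : Measurable fun x => ENNReal.ofReal (Real.exp (-(c * V.indicator 1 x))) := by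
    have : Measurable (V.indicator (1 : X → ℝ)) := measurable_one.indicator hV
    fun_prop
  have h := lintegral_mul_prod_law_le A I I' ha (fun x => by
    by_cases hx : x ∈ V
    · simpa [hx] using hin x hx
    · simpa [hx] using hout x hx) t (f := Set.indicator {z | playCount V z ≤ n} 1)
      (measurable_one.indicator hF)
  rw [lintegral_indicator_one hF] at h
  have h2 : ENNReal.ofReal (Real.exp (-(c * n))) * law A I t {z | playCount V z ≤ n}
      ≤ law A I' t {z | playCount V z ≤ n} := by
    refine le_trans ?_ h
    rw [← lintegral_indicator_const hF]
    refine lintegral_mono fun z => ?_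
    by_cases hz : z ∈ {z : A.Seed × History X t | playCount V z ≤ n}
    · rw [Set.indicator_of_mem hz, Set.indicator_of_mem hz, Pi.one_apply, one_mul,
        ← ENNReal.ofReal_prod_of_nonneg (fun _ _ => (Real.exp_pos _).le), ← Real.exp_sum,
        Finset.sum_neg_distrib, ← Finset.mul_sum]
      have hz' : playCount V z ≤ n := hz
      change _ ≤ ENNReal.ofReal (Real.exp (-(c * playCount V z)))
      gcongr
    · simp [Set.indicator_of_notMem hz]
  have h3 := ENNReal.toReal_mono (measure_ne_top _ _) h2
  rwa [ENNReal.toReal_mul, ENNReal.toReal_ofReal (Real.exp_pos _).le] at h3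

end ChangeOfMeasure

/-! ### Regret and the logarithmic lower bound on plays -/

section Regret

variable {X : Type u} [MetricSpace X] [MeasurableSpace X]

theorem Problem.le_iSup_mean (I : Problem X) (x : X) : I.mean x ≤ ⨆ x, I.mean x :=
  le_ciSup ⟨1, Set.forall_mem_range.2 fun x => (I.mean_mem x).2⟩ x

variable [OpensMeasurableSpace X]

theorem integrable_sum_mean (A : Algorithm.{u, v} X) (I : Problem X) (t : ℕ) :
    Integrable (fun z => ∑ s : Fin t, I.mean (z.2 s).1) (law A I t) := by
  have hm : Measurable I.mean := I.lipschitz.continuous.measurable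
  refine Integrable.of_bound (C := t) (by fun_prop : Measurable _).aestronglyMeasurable
    (Eventually.of_forall fun z => ?_)
  rw [Real.norm_of_nonneg (Finset.sum_nonneg fun _ _ => (I.mean_mem _).1)]
  calc ∑ s : Fin t, I.mean (z.2 s).1 ≤ ∑ _s : Fin t, (1 : ℝ) :=
        Finset.sum_le_sum fun _ _ => (I.mean_mem _).2
    _ = t := by simp

theorem regret_eq_integral (A : Algorithm.{u, v} X) (I : Problem X) (t : ℕ) :
    regret A I t = ∫ z, (t * (⨆ x, I.mean x) - ∑ s : Fin t, I.mean (z.2 s).1) ∂(law A I t) := by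
  rw [integral_sub (integrable_const _) (integrable_sum_mean A I t)]
  simp [regret]

theorem integral_le_regret (A : Algorithm.{u, v} X) (I : Problem X) (t : ℕ)
    {g : A.Seed × History X t → ℝ} (hg : Integrable g (law A I t))
    (h : ∀ z, g z ≤ ∑ s : Fin t, ((⨆ x, I.mean x) - I.mean (z.2 s).1)) :
    ∫ z, g z ∂(law A I t) ≤ regret A I t := by
  rw [regret_eq_integral]
  refine integral_mono hg ((integrable_const _).sub (integrable_sum_mean A I t)) fun z => ?_
  refine (h z).trans_eq ?_
  simp

/-- Few plays in `V` mean linear regret on `I'`, so this event is unlikely under `I'`. With `n = log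
t / (2 * c)` the change of measure costs only a factor `√t`, so the event has probability at most
`1/2` under `I`, and the expected count is at least `n / 2`. -/
theorem eventually_log_div_le_integral_playCount (A : Algorithm.{u, v} X) (I I' : Problem X)
    {V : Set X} (hV : MeasurableSet V) {c δ : ℝ} (hc : 0 < c) (hδ : 0 < δ)
    (hin : ∀ x ∈ V, ENNReal.ofReal (Real.exp (-c)) • I.payoff x ≤ I'.payoff x)
    (hout : ∀ x ∉ V, I.payoff x ≤ I'.payoff x)
    (hgap : ∀ x ∉ V, I'.mean x + δ ≤ ⨆ x, I'.mean x)
    (hreg : (fun t : ℕ => regret A I' t) =O[atTop] fun t : ℕ => Real.log t) :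
    ∀ᶠ t : ℕ in atTop, Real.log t / (4 * c) ≤ ∫ z, playCount V z ∂(law A I t) := by
  obtain ⟨C, hC⟩ := hreg.bound
  have hlog : Tendsto (fun t : ℕ => Real.log t) atTop atTop :=
    Real.tendsto_log_atTop.comp tendsto_natCast_atTop_atTop
  have hsmall : ∀ᶠ t : ℕ in atTop, Real.log t ≤ c * t := by
    have := (Real.isLittleO_log_id_atTop.comp_tendsto
      (tendsto_natCast_atTop_atTop (R := ℝ))).bound hc
    filter_upwards [this] with t ht
    simp only [Function.comp_apply, id, Real.norm_eq_abs, Nat.abs_cast] at ht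
    exact (le_abs_self _).trans ht
  -- Here `exp (log t / 2)` is `√t`.
  have hexp : ∀ᶠ t : ℕ in atTop, C * Real.log t ≤ δ / 4 * Real.exp (Real.log t / 2) := by
    have h1 : (fun x : ℝ => C * x) =o[atTop] fun x => Real.exp ((1 / 2) * x) := by
      have := isLittleO_pow_exp_pos_mul_atTop 1 (show (0 : ℝ) < 1 / 2 by norm_num)
      simpa using this.const_mul_left C
    filter_upwards [(h1.comp_tendsto hlog).bound (show 0 < δ / 4 by positivity)] with t ht
    simp only [Function.comp_apply, Real.norm_eq_abs, Real.abs_exp] at ht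
    refine (le_abs_self _).trans (ht.trans_eq ?_)
    ring_nf
  filter_upwards [hC, hsmall, hexp, hlog.eventually_ge_atTop 0, eventually_gt_atTop 0]
    with t hCt hst het hlt ht
  have htpos : (0 : ℝ) < t := by exact_mod_cast ht
  rw [Real.norm_eq_abs, Real.norm_of_nonneg hlt] at hCt
  replace hCt := (le_abs_self _).trans hCt
  set L := Real.log t with hL
  set n := L / (2 * c) with hn
  have hn0 : 0 ≤ n := by positivity
  have hnt : n ≤ t / 2 := by
    rw [hn, div_le_iff₀ (by positivity)]
    linarith
  have hF : MeasurableSet {z : A.Seed × History X t | playCount V z ≤ n} :=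
    measurableSet_le (measurable_playCount hV) measurable_const
  have hcm := exp_neg_mul_measureReal_le A I I' hV hc.le hin hout t n
  have hcn : c * n = L / 2 := by rw [hn]; field_simp
  rw [hcn] at hcm
  -- On the event at least `t / 2` rounds leave `V`, each losing at least `δ`.
  have hR : δ * (t / 2) * (law A I' t).real {z | playCount V z ≤ n} ≤ regret A I' t := by
    have := integral_le_regret A I' t
      (g := Set.indicator {z | playCount V z ≤ n} fun _ => δ * (t / 2))
      ((integrable_const _).indicator hF) fun z => ?_
    · rwa [integral_indicator_const _ hF, smul_eq_mul, mul_comm] at this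
    · have hz0 : δ * (t - playCount V z) ≤
          ∑ s : Fin t, ((⨆ x, I'.mean x) - I'.mean (z.2 s).1) := by
        calc δ * (t - playCount V z) = ∑ s : Fin t, δ * (1 - V.indicator 1 (z.2 s).1) := by
              rw [← Finset.mul_sum, Finset.sum_sub_distrib]
              simp [playCount]
          _ ≤ _ := Finset.sum_le_sum fun s _ => by
              by_cases hx : (z.2 s).1 ∈ V
              · simpa [hx] using I'.le_iSup_mean _
              · have := hgap _ hx
                simp only [hx, not_false_eq_true, Set.indicator_of_notMem]
                linarith
      refine le_trans ?_ hz0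
      have hz1 := playCount_le V z
      by_cases hz : z ∈ {z : A.Seed × History X t | playCount V z ≤ n}
      · rw [Set.indicator_of_mem hz]
        have hz' : playCount V z ≤ n := hz
        gcongr
        linarith
      · rw [Set.indicator_of_notMem hz]
        exact mul_nonneg hδ.le (by linarith)
  have hP : (law A I t).real {z | playCount V z ≤ n} ≤ 1 / 2 := by
    have hE : (t : ℝ) = Real.exp (L / 2) * Real.exp (L / 2) := by
      rw [← Real.exp_add, add_halves, hL, Real.exp_log htpos]
    have hEpos := Real.exp_pos (L / 2)
    have h1 : δ * (t / 2) * (Real.exp (-(L / 2)) * (law A I t).real {z | playCount V z ≤ n})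
        ≤ δ / 4 * Real.exp (L / 2) := by
      refine le_trans ?_ ((hR.trans hCt).trans het)
      gcongr
    rw [Real.exp_neg, hE] at h1
    have h2 : δ * (Real.exp (L / 2) * Real.exp (L / 2) / 2) *
        ((Real.exp (L / 2))⁻¹ * (law A I t).real {z | playCount V z ≤ n})
        = δ / 4 * Real.exp (L / 2) * (2 * (law A I t).real {z | playCount V z ≤ n}) := by
      field_simp
      ring
    rw [h2] at h1
    have := le_of_mul_le_mul_left (h1.trans_eq (mul_one _).symm) (by positivity)
    linarith
  have hPc : 1 / 2 ≤ (law A I t).real {z | playCount V z ≤ n}ᶜ := by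
    rw [probReal_compl_eq_one_sub hF]
    linarith
  calc L / (4 * c) = 1 / 2 * n := by rw [hn]; field_simp; norm_num
    _ ≤ (law A I t).real {z | playCount V z ≤ n}ᶜ * n := by gcongr
    _ = ∫ z, Set.indicator {z | playCount V z ≤ n}ᶜ (fun _ => n) z ∂(law A I t) := by
        rw [integral_indicator_const _ hF.compl, smul_eq_mul]
    _ ≤ _ := by
        refine integral_mono ((integrable_const _).indicator hF.compl)
          (integrable_playCount A I hV t) fun z => ?_
        refine Set.indicator_le' (fun z hz => ?_) (fun z _ => playCount_nonneg V z) z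
        rw [Set.mem_compl_iff, Set.mem_ofPred_eq, not_le] at hz
        exact hz.le

end Regret

/-! ### Bernoulli payoffs -/

section Bernoulli

/-- The Bernoulli distribution with success probability `p`, on the unit interval. -/
noncomputable def bernoulli (p : ℝ) : Measure unitInterval :=
  ENNReal.ofReal (1 - p) • Measure.dirac 0 + ENNReal.ofReal p • Measure.dirac 1

theorem smul_bernoulli_le {a p q : ℝ} (ha : 0 ≤ a) (h0 : a * (1 - p) ≤ 1 - q) (h1 : a * p ≤ q) :
    ENNReal.ofReal a • bernoulli p ≤ bernoulli q := by
  unfold bernoulli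
  rw [smul_add, smul_smul, smul_smul, ← ENNReal.ofReal_mul ha, ← ENNReal.ofReal_mul ha]
  refine Measure.le_intro fun s _ _ => ?_
  simp only [Measure.add_apply, Measure.smul_apply, smul_eq_mul]
  gcongr

variable {X : Type u} [MetricSpace X] [MeasurableSpace X] [OpensMeasurableSpace X]

/-- The instance with a given mean function and Bernoulli payoffs. -/
noncomputable def bernoulliProblem (m : X → ℝ) (hm : ∀ x, m x ∈ Set.Icc (0 : ℝ) 1)
    (hl : LipschitzWith 1 m) : Problem X where
  mean := m
  mean_mem := hm
  lipschitz := hl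
  payoff :=
    { toFun := fun x => bernoulli (m x)
      measurable' := by
        have hmm : Measurable m := hl.continuous.measurable
        refine Measure.measurable_of_measurable_coe _ fun s _ => ?_
        simp only [bernoulli, Measure.add_apply, Measure.smul_apply, smul_eq_mul]
        fun_prop }
  isMarkov := ⟨fun x => ⟨by
    have h1 := (hm x).1
    have h2 := (hm x).2
    simp only [Kernel.coe_mk, bernoulli, Measure.add_apply, Measure.smul_apply, smul_eq_mul,
      measure_univ, mul_one]
    rw [← ENNReal.ofReal_add (by linarith) h1]
    simp⟩⟩
  expectation x := by
    have h1 := (hm x).1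
    have h2 := (hm x).2
    simp only [Kernel.coe_mk, bernoulli]
    rw [integral_add_measure ((integrable_dirac (by simp)).smul_measure ENNReal.ofReal_ne_top)
      ((integrable_dirac (by simp)).smul_measure ENNReal.ofReal_ne_top)]
    simp [integral_smul_measure, h1]

end Bernoulli

/-! ### Disjoint balls and cones -/

section Construction

variable {X : Type u} [MetricSpace X]

theorem exists_seq_pairwise_disjoint_ball [Infinite X] :
    ∃ (x : ℕ → X) (r : ℕ → ℝ), (∀ n, 0 < r n) ∧ (∀ n, r n ≤ 1) ∧
      Pairwise (Function.onFun Disjoint fun n => Metric.ball (x n) (r n)) := by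
  obtain ⟨U, hinf, hopen, hdisj⟩ := exists_seq_infinite_isOpen_pairwise_disjoint X
  choose x hx using fun n => (hinf n).nonempty
  choose r hr hrU using fun n => Metric.isOpen_iff.1 (hopen n) (x n) (hx n)
  refine ⟨x, fun n => min (r n) 1, fun n => lt_min (hr n) one_pos, fun n => min_le_right _ _,
    fun i j hij => (hdisj hij).mono ?_ ?_⟩ <;>
  exact (Metric.ball_subset_ball (min_le_left _ _)).trans (hrU _)

/-- The cone of height `ρ` and slope `1` over the ball of radius `ρ` around `p`. -/
noncomputable def cone (p : X) (ρ : ℝ) (x : X) : ℝ := max (ρ - dist x p) 0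

theorem cone_nonneg (p : X) (ρ : ℝ) (x : X) : 0 ≤ cone p ρ x := le_max_right _ _

theorem cone_le {ρ : ℝ} (hρ : 0 ≤ ρ) (p x : X) : cone p ρ x ≤ ρ :=
  max_le (by linarith [dist_nonneg (x := x) (y := p)]) hρ

theorem cone_self {ρ : ℝ} (hρ : 0 ≤ ρ) (p : X) : cone p ρ p = ρ := by simp [cone, hρ]

theorem cone_eq_zero {p x : X} {ρ : ℝ} (h : x ∉ Metric.ball p ρ) : cone p ρ x = 0 :=
  max_eq_right (by rw [Metric.mem_ball, not_lt] at h; linarith)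

theorem cone_le_add (p : X) (ρ : ℝ) (x y : X) : cone p ρ x ≤ cone p ρ y + dist x y := by
  refine max_le ?_ (add_nonneg (cone_nonneg _ _ _) dist_nonneg)
  have h1 : ρ - dist y p ≤ cone p ρ y := le_max_left _ _
  have h2 := dist_triangle_left y p x
  linarith

/-- The upper envelope of a sequence of cones. -/
noncomputable def cones (x : ℕ → X) (r : ℕ → ℝ) (y : X) : ℝ := ⨆ n, cone (x n) (r n) y

variable {x : ℕ → X} {r : ℕ → ℝ}

theorem cone_le_cones (h0 : ∀ n, 0 < r n) (h1 : ∀ n, r n ≤ 1) (n : ℕ) (y : X) :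
    cone (x n) (r n) y ≤ cones x r y :=
  le_ciSup (f := fun n => cone (x n) (r n) y)
    ⟨1, Set.forall_mem_range.2 fun n => (cone_le (h0 n).le _ _).trans (h1 n)⟩ n

theorem cones_nonneg (y : X) : 0 ≤ cones x r y :=
  Real.iSup_nonneg fun _ => cone_nonneg _ _ _

theorem cones_le_one (h0 : ∀ n, 0 < r n) (h1 : ∀ n, r n ≤ 1) (y : X) : cones x r y ≤ 1 :=
  ciSup_le fun n => (cone_le (h0 n).le _ _).trans (h1 n)

theorem cones_le_add (h0 : ∀ n, 0 < r n) (h1 : ∀ n, r n ≤ 1) (y z : X) :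
    cones x r y ≤ cones x r z + dist y z :=
  ciSup_le fun n => (cone_le_add _ _ y z).trans (by gcongr; exact cone_le_cones h0 h1 n z)

theorem cones_eq_zero {y : X} (h : ∀ n, y ∉ Metric.ball (x n) (r n)) : cones x r y = 0 := by
  simp [cones, fun n => cone_eq_zero (h n)]

theorem cones_center_le (h0 : ∀ n, 0 < r n)
    (hd : Pairwise (Function.onFun Disjoint fun n => Metric.ball (x n) (r n))) (n : ℕ) :
    cones x r (x n) ≤ r n := by
  refine ciSup_le fun k => ?_
  rcases eq_or_ne k n with rfl | hk
  · exact cone_le (h0 k).le _ _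
  · rw [cone_eq_zero (Set.disjoint_right.1 (hd hk) (Metric.mem_ball_self (h0 n)))]
    exact (h0 n).le

end Construction

/-! ### The base and raised instances, and the contradiction -/

section Instances

variable {X : Type u} [MetricSpace X] [MeasurableSpace X] [OpensMeasurableSpace X]
  {x : ℕ → X} {r : ℕ → ℝ}

/-- The instance whose mean is `1/2`, lowered by a quarter of the cones. -/
noncomputable def baseProblem (h0 : ∀ n, 0 < r n) (h1 : ∀ n, r n ≤ 1) : Problem X :=
  bernoulliProblem (fun y => 1 / 2 - cones x r y / 4)
    (fun y => ⟨by linarith [cones_le_one (x := x) h0 h1 y], by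
      linarith [cones_nonneg (x := x) (r := r) y]⟩)
    (LipschitzWith.of_le_add fun y z => by
      have := cones_le_add (x := x) h0 h1 z y
      rw [dist_comm] at this
      linarith [dist_nonneg (x := y) (y := z)])

/-- The base instance, raised near the centre of the `i`-th ball just above `1/2`. -/
noncomputable def raisedProblem (h0 : ∀ n, 0 < r n) (h1 : ∀ n, r n ≤ 1) (i : ℕ) : Problem X :=
  bernoulliProblem (fun y => 1 / 2 - cones x r y / 4 + 3 / 4 * cone (x i) (r i / 2) y)
    (fun y => ⟨by
      linarith [cones_le_one (x := x) h0 h1 y, cone_nonneg (x i) (r i / 2) y], by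
      linarith [cones_nonneg (x := x) (r := r) y, cone_le (half_pos (h0 i)).le (x i) y, h1 i]⟩)
    -- The slopes `1/4` and `3/4` add up to exactly `1`.
    (LipschitzWith.of_le_add fun y z => by
      have h2 := cones_le_add (x := x) h0 h1 z y
      have h3 := cone_le_add (x i) (r i / 2) y z
      rw [dist_comm] at h2
      linarith)

/-- The success probability rises by at most `3 * r i / 8` and the base failure probability is at
least `1/2`, so the latter shrinks by a factor no smaller than `1 - 3 * r i / 4`. A cost linear in
`r i` suffices, as the gap is linear too. -/
theorem exp_neg_smul_base_payoff_le (h0 : ∀ n, 0 < r n) (h1 : ∀ n, r n ≤ 1) (i : ℕ) (y : X) :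
    ENNReal.ofReal (Real.exp (-(3 * r i))) • (baseProblem (x := x) h0 h1).payoff y
      ≤ (raisedProblem (x := x) h0 h1 i).payoff y := by
  have hr := h0 i
  have hr1 := h1 i
  have hc := cone_le (half_pos hr).le (x i) y
  have hc0 := cone_nonneg (x i) (r i / 2) y
  have hg := cones_le_one (x := x) h0 h1 y
  have hg0 := cones_nonneg (x := x) (r := r) y
  have hexp : Real.exp (-(3 * r i)) ≤ 1 - 3 * r i / 4 := by
    rw [Real.exp_neg, inv_le_iff_one_le_mul₀ (Real.exp_pos _)]
    have := Real.add_one_le_exp (3 * r i)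
    calc (1 : ℝ) ≤ (1 - 3 * r i / 4) * (3 * r i + 1) := by nlinarith
      _ ≤ _ := by gcongr; linarith
  have hexp1 : Real.exp (-(3 * r i)) ≤ 1 := by linarith
  refine smul_bernoulli_le (Real.exp_pos _).le ?_ ?_
  · refine (mul_le_mul_of_nonneg_right hexp (by linarith)).trans ?_
    nlinarith
  · refine (mul_le_of_le_one_left (by linarith) hexp1).trans ?_
    linarith

theorem base_payoff_eq (h0 : ∀ n, 0 < r n) (h1 : ∀ n, r n ≤ 1) (i : ℕ) {y : X}
    (hy : y ∉ Metric.ball (x i) (r i / 2)) :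
    (baseProblem (x := x) h0 h1).payoff y = (raisedProblem (x := x) h0 h1 i).payoff y := by
  change bernoulli (1 / 2 - cones x r y / 4)
    = bernoulli (1 / 2 - cones x r y / 4 + 3 / 4 * cone (x i) (r i / 2) y)
  rw [cone_eq_zero hy, mul_zero, add_zero]

/-- At the centre the mean is at least `1/2 - r i / 4 + 3 * r i / 8 = 1/2 + r i / 8`; outside the
half ball it is at most `1/2`. -/
theorem raised_gap (h0 : ∀ n, 0 < r n) (h1 : ∀ n, r n ≤ 1)
    (hd : Pairwise (Function.onFun Disjoint fun n => Metric.ball (x n) (r n))) (i : ℕ) {y : X}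
    (hy : y ∉ Metric.ball (x i) (r i / 2)) :
    (raisedProblem (x := x) h0 h1 i).mean y + r i / 8
      ≤ ⨆ y, (raisedProblem (x := x) h0 h1 i).mean y := by
  refine le_trans ?_ ((raisedProblem (x := x) h0 h1 i).le_iSup_mean (x i))
  change 1 / 2 - cones x r y / 4 + 3 / 4 * cone (x i) (r i / 2) y + r i / 8
    ≤ 1 / 2 - cones x r (x i) / 4 + 3 / 4 * cone (x i) (r i / 2) (x i)
  rw [cone_eq_zero hy, cone_self (half_pos (h0 i)).le]
  linarith [cones_center_le h0 hd i, cones_nonneg (x := x) (r := r) y]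

/-- By disjointness at most one summand is nonzero, and inside a half ball the full cone still has
height at least `r i / 2`. This lets the costs of different balls add up. -/
theorem base_gap (h0 : ∀ n, 0 < r n) (h1 : ∀ n, r n ≤ 1)
    (hd : Pairwise (Function.onFun Disjoint fun n => Metric.ball (x n) (r n)))
    {p : X} (hp : ∀ n, p ∉ Metric.ball (x n) (r n)) (K : ℕ) (y : X) :
    ∑ i ∈ Finset.range K, r i / 8 * (Metric.ball (x i) (r i / 2)).indicator 1 y
      ≤ (⨆ y, (baseProblem (x := x) h0 h1).mean y) - (baseProblem (x := x) h0 h1).mean y := by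
  have hsup := (baseProblem (x := x) h0 h1).le_iSup_mean p
  change 1 / 2 - cones x r p / 4 ≤ _ at hsup
  rw [cones_eq_zero hp] at hsup
  have hmean : (baseProblem (x := x) h0 h1).mean y = 1 / 2 - cones x r y / 4 := rfl
  suffices h : ∑ i ∈ Finset.range K, r i / 8 * (Metric.ball (x i) (r i / 2)).indicator 1 y
      ≤ cones x r y / 4 by linarith
  by_cases hy : ∃ i, y ∈ Metric.ball (x i) (r i / 2)
  · obtain ⟨i, hi⟩ := hy
    have hsub : ∀ j, Metric.ball (x j) (r j / 2) ⊆ Metric.ball (x j) (r j) := fun j =>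
      Metric.ball_subset_ball (half_le_self (h0 j).le)
    have hle : r i / 8 ≤ cones x r y / 4 := by
      have h2 : r i - dist y (x i) ≤ cone (x i) (r i) y := le_max_left _ _
      have h3 := cone_le_cones (x := x) h0 h1 i y
      rw [Metric.mem_ball] at hi
      linarith
    have hz : ∀ j, j ≠ i → r j / 8 * (Metric.ball (x j) (r j / 2)).indicator 1 y = 0 := by
      intro j hj
      rw [Set.indicator_of_notMem fun h =>
        Set.disjoint_left.1 (hd hj) (hsub j h) (hsub i hi), mul_zero]
    refine le_trans ?_ hle
    by_cases hiK : i ∈ Finset.range K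
    · rw [Finset.sum_eq_single_of_mem i hiK fun j _ hj => hz j hj, Set.indicator_of_mem hi]
      simp
    · rw [Finset.sum_eq_zero fun j hj => hz j fun h => hiK (h ▸ hj)]
      linarith [h0 i]
  · push Not at hy
    rw [Finset.sum_eq_zero fun i _ => by rw [Set.indicator_of_notMem (hy i), mul_zero]]
    linarith [cones_nonneg (x := x) (r := r) y]

theorem not_isBigO_base_regret (A : Algorithm.{u, v} X)
    (hA : ∀ I : Problem X, (fun t : ℕ => regret A I t) =O[atTop] fun t : ℕ => Real.log t)
    (h0 : ∀ n, 0 < r n) (h1 : ∀ n, r n ≤ 1)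
    (hd : Pairwise (Function.onFun Disjoint fun n => Metric.ball (x n) (r n)))
    {p : X} (hp : ∀ n, p ∉ Metric.ball (x n) (r n)) : False := by
  set I : Problem X := baseProblem (x := x) h0 h1
  have hN : ∀ i, ∀ᶠ t : ℕ in atTop, Real.log t / (4 * (3 * r i))
      ≤ ∫ z, playCount (Metric.ball (x i) (r i / 2)) z ∂(law A I t) := fun i =>
    eventually_log_div_le_integral_playCount A I (raisedProblem (x := x) h0 h1 i)
      measurableSet_ball (by linarith [h0 i]) (δ := r i / 8) (by linarith [h0 i])
      (fun y _ => exp_neg_smul_base_payoff_le h0 h1 i y)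
      (fun y hy => (base_payoff_eq h0 h1 i hy).le) (fun y hy => raised_gap h0 h1 hd i hy) (hA _)
  obtain ⟨C, hC⟩ := (hA I).bound
  -- Each ball costs `r i / 8 * (log t / (12 * r i)) = log t / 96`, so more than `96 * C` balls
  -- exceed the bound.
  obtain ⟨K, hK⟩ := exists_nat_gt (96 * C)
  have hlog : Tendsto (fun t : ℕ => Real.log t) atTop atTop :=
    Real.tendsto_log_atTop.comp tendsto_natCast_atTop_atTop
  have hall := (Finset.eventually_all (Finset.range K)).2 fun i _ => hN i
  obtain ⟨t, hCt, hlt, ht⟩ := (hC.and ((hlog.eventually_gt_atTop 0).and hall)).exists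
  rw [Real.norm_eq_abs, Real.norm_of_nonneg hlt.le] at hCt
  have hint : ∀ i ∈ Finset.range K, Integrable
      (fun z => r i / 8 * playCount (Metric.ball (x i) (r i / 2)) z) (law A I t) := fun i _ =>
    (integrable_playCount A I measurableSet_ball t).const_mul _
  have hR := integral_le_regret A I t (integrable_finsetSum _ hint) fun z => by
    simp only [playCount, Finset.mul_sum]
    rw [Finset.sum_comm]
    exact Finset.sum_le_sum fun s _ => base_gap h0 h1 hd hp K (z.2 s).1
  rw [integral_finsetSum _ hint] at hR
  have hlow : (K : ℝ) * (Real.log t / 96) ≤ regret A I t := by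
    refine le_trans ?_ hR
    calc (K : ℝ) * (Real.log t / 96) = ∑ _i ∈ Finset.range K, Real.log t / 96 := by simp
      _ ≤ _ := Finset.sum_le_sum fun i hi => by
        have hr := h0 i
        rw [integral_const_mul]
        calc Real.log t / 96 = r i / 8 * (Real.log t / (4 * (3 * r i))) := by
              field_simp
              norm_num
          _ ≤ _ := by
              have := ht i hi
              gcongr
  have := (le_abs_self _).trans hCt
  nlinarith

end Instances

end LipschitzMAB

theorem mainTheorem6 (X : Type u) [MetricSpace X] [MeasurableSpace X] [BorelSpace X] [Infinite X] :
    ¬ LipschitzMAB.IsTractable.{u, v} X (fun t : ℕ => Real.log t) := by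
  rintro ⟨A, hA⟩
  obtain ⟨x, r, h0, h1, hd⟩ := LipschitzMAB.exists_seq_pairwise_disjoint_ball (X := X)
  -- The ball of index `0` is set aside: its centre is the optimal arm of the base instance.
  refine LipschitzMAB.not_isBigO_base_regret (x := fun n => x (n + 1)) (r := fun n => r (n + 1))
    (p := x 0) A hA (fun n => h0 _) (fun n => h1 _) (fun i j hij => hd (by simpa using hij))
    fun n hn => ?_
  exact Set.disjoint_left.1 (hd (Nat.succ_ne_zero n).symm) (Metric.mem_ball_self (h0 0)) hn
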